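/- **Theorem (Characterizations of the winning sets).** An arena consists of a countable set $V$ of vertices, partitioned into Eve's vertices $V_E$ and Adam's vertices $V_A$, and an edge relation $E \subseteq V \times V$ such that every vertex has an outgoing edge. A strategy for Eve (resp. Adam) is a function $\sigma : V^* \cdot V_E \to V$ (resp. $\tau : V^* \cdot V_A \to V$) that maps a finite history and a current vertex $v$ to a successor of $v$; a starting vertex $v_0$, a strategy $\sigma$ for Eve and a strategy $\tau$ for Adam determine a unique infinite play. For a set $\Omega$ of plays, $W_E(\Omega)$ is the set of vertices $v_0$ such that Eve has a strategy $\sigma$ for which, for all strategies $\tau$ of Adam, the play from $v_0$ given by $\sigma$ and $\tau$ is in $\Omega$. For $S \subseteq V$ let $$\mathrm{Pre}(S) = \{u \in V_E \mid \exists (u,v) \in E,\ v \in S\} \cup \{u \in V_A \mid \forall (u,v) \in E,\ v \in S\},$$ $\mathrm{Attr}_0(S) = S$ and $\mathrm{Attr}_{k+1}(S) = \mathrm{Attr}_k(S) \cup \mathrm{Pre}(\mathrm{Attr}_k(S))$. For $F \subseteq V$, a play $\pi = \pi_0 \pi_1 \cdots$ and a position $k$, let $\mathrm{dist}_k(\pi,F)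 = \inf\{k'-k \mid k' \ge k,\ \pi_{k'} \in F\} \in \mathbb{N} \cup \{\infty\}$ (with $\inf \emptyset = \infty$), and for $N \in \mathbb{N}$ let $$\mathrm{BndB\ddot{u}chi}(F,N) = \{\pi \mid \sup_k \mathrm{dist}_k(\pi,F) \le N\},\quad \mathrm{B\ddot{u}chi}(F,N) = \{\pi \mid \limsup_k \mathrm{dist}_k(\pi,F) \le N\},$$ $$\mathrm{FinB\ddot{u}chi}(F) = \{\pi \mid \limsup_k \mathrm{dist}_k(\pi,F) < \infty\}.$$ Write $\mu$ and $\nu$ for the least and greatest fixpoints of monotone operators on the subsets of $V$, ordered by inclusion. Then for every arena and every $F \subseteq V$: 1. for all $N \ge 0$, $W_E(\mathrm{BndB\ddot{u}chi}(F,N)) = \nu Z.\ \mathrm{Attr}_N(F \cap \mathrm{Pre}(Z))$; 2. for all $N \ge 1$, $W_E(\mathrm{B\ddot{u}chi}(F,N)) = \mu Y.\ \nu Z.\ \mathrm{Attr}_N((F \cup Y) \cap \mathrm{Pre}(Z))$; 3. $W_E(\mathrm{FinB\ddot{u}chi}(F)) = \mu X.\ \bigcup_{N \in \mathbb{N}}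 \mu Y.\ \nu Z.\ \mathrm{Attr}_N((F \cup Y \cup X) \cap \mathrm{Pre}(Z))$. -/

import Mathlib

/-- An arena with vertex set `V`: the edge relation `E`, the set `VE` of Eve's vertices (all other
vertices belong to Adam), and no dead ends. -/
structure Arena (V : Type*) where
  VE : Set V
  E : V → V → Prop
  noDeadEnd : ∀ v, ∃ v', E v v'

namespace Arena

variable {V : Type*} (A : Arena V)

/-- The set of Adam's vertices. -/
def VA : Set V := A.VEᶜ

/-- A strategy for Eve: a function `V^* · V_E → V` (past history, then current vertex) whose moves
follow edges. -/
structure EveStrategy where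
  move : List V → A.VE → V
  legal : ∀ (w : List V) (v : A.VE), A.E v (move w v)

/-- A strategy for Adam: a function `V^* · V_A → V` whose moves follow edges. -/
structure AdamStrategy where
  move : List V → A.VA → V
  legal : ∀ (w : List V) (v : A.VA), A.E v (move w v)

open Classical in
/-- The position after `n` moves: the vertices visited before (in chronological order) and the
current vertex. -/
noncomputable def run (v₀ : V) (σ : A.EveStrategy) (τ : A.AdamStrategy) : ℕ → List V × V
  | 0 => ([], v₀)
  | n + 1 =>
    let w := (run v₀ σ τ n).1
    let v := (run v₀ σ τ n).2
    (w ++ [v], if h : v ∈ A.VE then σ.move w ⟨v, h⟩ else τ.move w ⟨v, h⟩)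

/-- The unique play from `v₀` in which Eve follows `σ` and Adam follows `τ`. -/
noncomputable def play (v₀ : V) (σ : A.EveStrategy) (τ : A.AdamStrategy) (n : ℕ) : V :=
  (A.run v₀ σ τ n).2

/-- Eve's winning set for the condition `Ω`. -/
def winE (Ω : Set (ℕ → V)) : Set V :=
  {v₀ | ∃ σ : A.EveStrategy, ∀ τ : A.AdamStrategy, A.play v₀ σ τ ∈ Ω}

/-- The vertices from which Eve can ensure to be in `F` after one move. -/
def pre (F : Set V) : Set V :=
  {u | u ∈ A.VE ∧ ∃ v, A.E u v ∧ v ∈ F} ∪ {u | u ∈ A.VA ∧ ∀ v, A.E u v → v ∈ F}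

/-- The step-indexed attractor sequence for Eve. -/
def attr : ℕ → Set V → Set V
  | 0, F => F
  | k + 1, F => attr k F ∪ A.pre (attr k F)

theorem pre_mono : Monotone A.pre := by
  rintro S T h u (⟨hu, v, hv, hS⟩ | ⟨hu, hS⟩)
  · exact Or.inl ⟨hu, v, hv, h hS⟩
  · exact Or.inr ⟨hu, fun v hv => h (hS v hv)⟩

theorem attr_mono (N : ℕ) : Monotone (A.attr N) := by
  induction N with
  | zero => exact fun S T h => h
  | succ k ih => exact fun S T h => Set.union_subset_union (ih h) (A.pre_mono (ih h))

/-- The monotone operator `Z ↦ Attr_N (S ∩ Pre Z)`. -/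
def attrPre (N : ℕ) (S : Set V) : Set V →o Set V where
  toFun Z := A.attr N (S ∩ A.pre Z)
  monotone' _ _ h := A.attr_mono N (Set.inter_subset_inter_right S (A.pre_mono h))

theorem attrPre_mono (N : ℕ) : Monotone (A.attrPre N) :=
  fun _ _ h _ => A.attr_mono N (Set.inter_subset_inter_left _ h)

/-- The monotone operator `Y ↦ νZ. Attr_N ((F ∪ Y) ∩ Pre Z)`. -/
def uniformOp (N : ℕ) (F : Set V) : Set V →o Set V where
  toFun Y := (A.attrPre N (F ∪ Y)).gfp
  monotone' _ _ h :=
    OrderHom.gfp.monotone (A.attrPre_mono N (Set.union_subset_union_right F h))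

/-- The monotone operator `Y ↦ νZ. Attr_N ((F ∪ Y ∪ X) ∩ Pre Z)`. -/
def finitaryInnerOp (N : ℕ) (F X : Set V) : Set V →o Set V where
  toFun Y := (A.attrPre N (F ∪ Y ∪ X)).gfp
  monotone' _ _ h := OrderHom.gfp.monotone (A.attrPre_mono N
    (Set.union_subset_union_left X (Set.union_subset_union_right F h)))

theorem finitaryInnerOp_mono (N : ℕ) (F : Set V) : Monotone (A.finitaryInnerOp N F) :=
  fun _ _ h Y => OrderHom.gfp.monotone (A.attrPre_mono N (Set.union_subset_union_right (F ∪ Y) h))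

/-- The monotone operator `X ↦ ⋃_N μY. νZ. Attr_N ((F ∪ Y ∪ X) ∩ Pre Z)`. -/
def finitaryOp (F : Set V) : Set V →o Set V where
  toFun X := ⋃ N : ℕ, (A.finitaryInnerOp N F X).lfp
  monotone' _ _ h :=
    Set.iUnion_mono fun N => OrderHom.lfp.monotone (A.finitaryInnerOp_mono N F h)

end Arena

/-- The number of steps from position `k` of `π` to the next vertex in `F` (`⊤` if there is
none). -/
noncomputable def buchiDist {V : Type*} (F : Set V) (π : ℕ → V) (k : ℕ) : ℕ∞ :=
  ⨅ (k' : ℕ) (_ : k ≤ k' ∧ π k' ∈ F), ((k' - k : ℕ) : ℕ∞)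

/-- The bounded uniform Büchi condition with bound `N`. -/
def BndBuchi {V : Type*} (F : Set V) (N : ℕ) : Set (ℕ → V) :=
  {π | (⨆ k, buchiDist F π k) ≤ (N : ℕ∞)}

/-- The uniform Büchi condition with bound `N`. -/
def UniformBuchi {V : Type*} (F : Set V) (N : ℕ) : Set (ℕ → V) :=
  {π | Filter.limsup (buchiDist F π) Filter.atTop ≤ (N : ℕ∞)}

/-- The finitary Büchi condition. -/
def FinBuchi {V : Type*} (F : Set V) : Set (ℕ → V) :=
  {π | Filter.limsup (buchiDist F π) Filter.atTop < ⊤}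

/-!
Fix a strategy of Eve and consider the plays consistent with it. For `BndBuchi F N`, every
consistent play meets `F` within `N` steps and the winning set is preserved along it; conversely
Eve decreases the attractor rank until she reaches `F ∩ Pre Z`, and then moves back into `Z`.

For the other two conditions, call the least fixpoint `X`. The winning set is a prefixpoint because
Eve may play for the weaker condition in which winning vertices count as visits to `F`, and change
to a winning strategy at the first such visit. It is contained in `X` by a diagonal construction:
outside `X` Eve does not win the bounded condition for `F ∪ X`, so against any strategy of hers
there is a continuation with a window of length `N` avoiding `F ∪ X`. The end of that window is
again outside `X`, and later than its beginning when `N ≥ 1`, so the windows can be repeated with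
prescribed lengths; their limit is a consistent play violating the condition.
-/

namespace Arena

variable {V : Type*} {A : Arena V}

section History

/-- The vertices `π 0, …, π (n - 1)` visited by `π` before time `n`, as the list that is passed to
a strategy at time `n`. -/
def history (π : ℕ → V) (n : ℕ) : List V := (List.range n).map π

theorem history_succ (π : ℕ → V) (n : ℕ) : history π (n + 1) = history π n ++ [π n] := by
  simp [history, List.range_succ]

theorem history_add (π : ℕ → V) (n k : ℕ) :
    history π (n + k) = history π n ++ history (fun i => π (n + i)) k := by
  simp [history, List.range_add, Function.comp_def]

theorem mem_history {π : ℕ → V} {n : ℕ} {u : V} : u ∈ history π n ↔ ∃ i < n, π i = u := by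
  simp [history]

theorem length_history (π : ℕ → V) (n : ℕ) : (history π n).length = n := by
  simp [history]

theorem history_congr {π π' : ℕ → V} {n : ℕ} (h : Set.EqOn π π' (Set.Iio n)) :
    history π n = history π' n :=
  List.map_congr_left fun _ hk => h (List.mem_range.1 hk)

/-- The sequence `π 0, …, π (n - 1), ρ 0, ρ 1, …`, used to continue a play by another one. -/
def splice (π : ℕ → V) (n : ℕ) (ρ : ℕ → V) (k : ℕ) : V := if k < n then π k else ρ (k - n)

theorem splice_add (π : ℕ → V) (n : ℕ) (ρ : ℕ → V) (k : ℕ) : splice π n ρ (n + k) = ρ k := by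
  simp [splice]

theorem splice_eqOn_Iio (π : ℕ → V) (n : ℕ) (ρ : ℕ → V) :
    Set.EqOn (splice π n ρ) π (Set.Iio n) :=
  fun _ hk => if_pos hk

theorem splice_eqOn_Iic {π : ℕ → V} {n : ℕ} {ρ : ℕ → V} (hρ : ρ 0 = π n) :
    Set.EqOn (splice π n ρ) π (Set.Iic n) := by
  intro k hk
  obtain rfl | hlt := (Set.mem_Iic.1 hk).eq_or_lt
  · exact (splice_add π k ρ 0).trans hρ
  · exact splice_eqOn_Iio π n ρ hlt

theorem exists_eqOn_Iic_of_eqOn_succ {p : ℕ → ℕ → V} {n : ℕ → ℕ} (hn : StrictMono n)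
    (h : ∀ i, Set.EqOn (p (i + 1)) (p i) (Set.Iic (n i))) :
    ∃ π : ℕ → V, ∀ i, Set.EqOn π (p i) (Set.Iic (n i)) := by
  have hstable : ∀ i j, i ≤ j → Set.EqOn (p j) (p i) (Set.Iic (n i)) := by
    intro i j hij
    induction j, hij using Nat.le_induction with
    | base => exact fun _ _ => rfl
    | succ j hij ih => exact ((h j).mono (Set.Iic_subset_Iic.2 (hn.monotone hij))).trans ih
  refine ⟨fun k => p k k, fun i k hk => ?_⟩
  obtain hik | hki := le_total i k
  · exact hstable i k hik hk
  · exact (hstable k i hki hn.le_apply).symm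

end History

section Consistent

/-- The strategy that plays like `σ` after the history `w`. -/
def EveStrategy.residual (σ : A.EveStrategy) (w : List V) : A.EveStrategy where
  move w' v := σ.move (w ++ w') v
  legal w' v := σ.legal (w ++ w') v

/-- The move of `π` at time `n` follows an edge, which is the one prescribed by `σ` if the current
vertex belongs to Eve. -/
def EveStrategy.Follows (σ : A.EveStrategy) (π : ℕ → V) (n : ℕ) : Prop :=
  A.E (π n) (π (n + 1)) ∧ ∀ h : π n ∈ A.VE, π (n + 1) = σ.move (history π n) ⟨π n, h⟩

/-- The play `π` starts in `v₀` and all its moves are compatible with `σ`. These are the plays from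
`v₀` given by `σ` and the strategies of Adam, described without reference to Adam. -/
structure EveStrategy.Consistent (σ : A.EveStrategy) (v₀ : V) (π : ℕ → V) : Prop where
  start : π 0 = v₀
  follows (n : ℕ) : σ.Follows π n

variable {σ : A.EveStrategy} {v : V} {π ρ : ℕ → V} {n : ℕ}

theorem EveStrategy.Follows.congr (h : σ.Follows π n) (hρ : Set.EqOn ρ π (Set.Iic (n + 1))) :
    σ.Follows ρ n := by
  have hn : ρ n = π n := hρ (Set.mem_Iic.2 n.le_succ)
  have hsucc : ρ (n + 1) = π (n + 1) := hρ Set.self_mem_Iic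
  have hhist : history ρ n = history π n :=
    history_congr (hρ.mono fun k hk => (le_of_lt hk).trans n.le_succ)
  simpa only [Follows, hn, hsucc, hhist] using h

theorem EveStrategy.follows_residual_history {k : ℕ} :
    (σ.residual (history π n)).Follows (fun i => π (n + i)) k ↔ σ.Follows π (n + k) := by
  simp only [Follows, residual, ← history_add, Nat.add_assoc]

theorem EveStrategy.Consistent.splice (hπ : σ.Consistent v π)
    (hρ : (σ.residual (history π n)).Consistent (π n) ρ) : σ.Consistent v (splice π n ρ) := by
  have heq := splice_eqOn_Iic hρ.start
  refine ⟨(heq (Set.mem_Iic.2 n.zero_le)).trans hπ.start, fun k => ?_⟩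
  obtain hk | hk := lt_or_ge k n
  · exact (hπ.follows k).congr (heq.mono (Set.Iic_subset_Iic.2 hk))
  · obtain ⟨k, rfl⟩ := Nat.exists_eq_add_of_le hk
    rw [← follows_residual_history, history_congr (splice_eqOn_Iio π n ρ)]
    simpa only [splice_add] using hρ.follows k

theorem EveStrategy.Consistent.of_forall_eqOn_Iic
    (h : ∀ n, ∃ ρ, σ.Consistent v ρ ∧ Set.EqOn π ρ (Set.Iic n)) : σ.Consistent v π := by
  refine ⟨?_, fun n => ?_⟩
  · obtain ⟨ρ, hρ, heq⟩ := h 0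
    exact (heq Set.self_mem_Iic).trans hρ.start
  · obtain ⟨ρ, hρ, heq⟩ := h (n + 1)
    exact (hρ.follows n).congr heq

end Consistent

section WinningSet

open Classical in
/-- A successor of `v`, chosen in `S` whenever `v` has a successor in `S`. It serves to define
strategies that try to move into a given set. -/
noncomputable def succIn (A : Arena V) (v : V) (S : Set V) : V :=
  if h : ∃ u ∈ S, A.E v u then h.choose else (A.noDeadEnd v).choose

theorem edge_succIn (v : V) (S : Set V) : A.E v (A.succIn v S) := by
  unfold succIn
  split_ifs with h
  · exact h.choose_spec.2
  · exact (A.noDeadEnd v).choose_spec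

theorem succIn_mem {u v : V} {S : Set V} (hE : A.E v u) (hu : u ∈ S) : A.succIn v S ∈ S := by
  have h : ∃ u ∈ S, A.E v u := ⟨u, hu, hE⟩
  rw [succIn, dif_pos h]
  exact h.choose_spec.1

variable {σ : A.EveStrategy} {v : V} {π : ℕ → V} {Ω Ω' : Set (ℕ → V)}

theorem fst_run_eq_history (v : V) (σ : A.EveStrategy) (τ : A.AdamStrategy) (n : ℕ) :
    (A.run v σ τ n).1 = history (A.play v σ τ) n := by
  induction n with
  | zero => rfl
  | succ n ih => rw [history_succ, ← ih]; rfl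

open Classical in
theorem play_succ (v : V) (σ : A.EveStrategy) (τ : A.AdamStrategy) (n : ℕ) :
    A.play v σ τ (n + 1) =
      if h : A.play v σ τ n ∈ A.VE then
        σ.move (history (A.play v σ τ) n) ⟨A.play v σ τ n, h⟩
      else τ.move (history (A.play v σ τ) n) ⟨A.play v σ τ n, h⟩ := by
  rw [← fst_run_eq_history]; rfl

theorem EveStrategy.consistent_play (v : V) (σ : A.EveStrategy) (τ : A.AdamStrategy) :
    σ.Consistent v (A.play v σ τ) := by
  refine ⟨rfl, fun n => ⟨?_, fun h => by rw [play_succ, dif_pos h]⟩⟩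
  rw [play_succ]
  split_ifs with h
  · exact σ.legal _ ⟨_, h⟩
  · exact τ.legal _ ⟨_, h⟩

theorem EveStrategy.Consistent.exists_play_eq (hπ : σ.Consistent v π) :
    ∃ τ, A.play v σ τ = π := by
  let τ : A.AdamStrategy :=
    ⟨fun w u => A.succIn u {π (w.length + 1)}, fun _ u => A.edge_succIn u _⟩
  refine ⟨τ, funext fun n => ?_⟩
  induction n using Nat.strong_induction_on with
  | _ n ih =>
    cases n with
    | zero => exact hπ.start.symm
    | succ n =>
      have hn : A.play v σ τ n = π n := ih n n.lt_succ_self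
      have hhist : history (A.play v σ τ) n = history π n :=
        history_congr fun k hk => ih k (Nat.lt_succ_of_lt hk)
      rw [play_succ, hhist]
      simp only [hn]
      split_ifs with h
      · exact ((hπ.follows n).2 (hn ▸ h)).symm
      · simp only [τ, length_history]
        exact Set.mem_singleton_iff.1 (succIn_mem (hπ.follows n).1 (Set.mem_singleton _))

theorem mem_winE_iff : v ∈ A.winE Ω ↔ ∃ σ : A.EveStrategy, ∀ π, σ.Consistent v π → π ∈ Ω := by
  refine exists_congr fun σ => ⟨fun h π hπ => ?_, fun h τ => h _ (σ.consistent_play v τ)⟩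
  obtain ⟨τ, rfl⟩ := hπ.exists_play_eq
  exact h τ

theorem EveStrategy.exists_consistent (σ : A.EveStrategy) (v : V) : ∃ π, σ.Consistent v π :=
  ⟨_, σ.consistent_play v ⟨fun _ u => A.succIn u Set.univ, fun _ u => A.edge_succIn u _⟩⟩

theorem winE_mono (h : Ω ⊆ Ω') : A.winE Ω ⊆ A.winE Ω' :=
  fun _ ⟨σ, hσ⟩ => ⟨σ, fun τ => h (hσ τ)⟩

theorem EveStrategy.Consistent.mem_winE_of_splice (hσ : ∀ π, σ.Consistent v π → π ∈ Ω)
    (hπ : σ.Consistent v π) {n : ℕ} (h : ∀ ρ, ρ 0 = π n → Arena.splice π n ρ ∈ Ω → ρ ∈ Ω') :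
    π n ∈ A.winE Ω' :=
  mem_winE_iff.2 ⟨σ.residual (history π n), fun _ hρ => h _ hρ.start (hσ _ (hπ.splice hρ))⟩

theorem EveStrategy.Consistent.mem_winE_of_suffix_closed
    (hΩ : ∀ π ∈ Ω, ∀ n, (fun k => π (n + k)) ∈ Ω) (hσ : ∀ π, σ.Consistent v π → π ∈ Ω)
    (hπ : σ.Consistent v π) (n : ℕ) : π n ∈ A.winE Ω :=
  hπ.mem_winE_of_splice hσ fun ρ _ h => by simpa only [splice_add] using hΩ _ h n

end WinningSet

section Attractor

variable {S Z : Set V}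

theorem winE_next_subset_pre (S : Set V) : A.winE {π | π 1 ∈ S} ⊆ A.pre S := by
  rintro v ⟨σ, hσ⟩
  let toward (u : V) : A.AdamStrategy :=
    ⟨fun _ u' => A.succIn u' {u}, fun _ u' => A.edge_succIn u' _⟩
  have hnext (u : V) : A.play v σ (toward u) 1 ∈ S := hσ (toward u)
  by_cases hv : v ∈ A.VE
  · exact Or.inl ⟨hv, _, ((σ.consistent_play v (toward v)).follows 0).1, hnext v⟩
  · refine Or.inr ⟨hv, fun u hu => ?_⟩
    have hplay : A.play v σ (toward u) 1 = u :=
      (dif_neg hv).trans (succIn_mem hu (Set.mem_singleton u))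
    exact hplay ▸ hnext u

theorem winE_subset_pre_of_suffix_closed {Ω : Set (ℕ → V)}
    (hΩ : ∀ π ∈ Ω, ∀ n, (fun k => π (n + k)) ∈ Ω) : A.winE Ω ⊆ A.pre (A.winE Ω) := by
  intro v hv
  obtain ⟨σ, hσ⟩ := mem_winE_iff.1 hv
  exact winE_next_subset_pre _ (mem_winE_iff.2
    ⟨σ, fun _ hπ => hπ.mem_winE_of_suffix_closed hΩ hσ 1⟩)

theorem monotone_attr (S : Set V) : Monotone fun k => A.attr k S :=
  monotone_nat_of_le_succ fun _ => Set.subset_union_left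

theorem attr_succ (k : ℕ) (S : Set V) : A.attr (k + 1) S = S ∪ A.pre (A.attr k S) := by
  induction k with
  | zero => rfl
  | succ k ih =>
    have hpre : A.pre (A.attr k S) ⊆ A.pre (A.attr (k + 1) S) :=
      A.pre_mono (monotone_attr S k.le_succ)
    rw [attr, ih, Set.union_assoc, ← ih, Set.union_eq_self_of_subset_left hpre]

theorem winE_reach_subset_attr (k : ℕ) (S : Set V) :
    A.winE {π | ∃ j ≤ k, π j ∈ S} ⊆ A.attr k S := by
  induction k with
  | zero =>
    rintro v hv
    obtain ⟨σ, hσ⟩ := mem_winE_iff.1 hv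
    obtain ⟨π, hπ⟩ := σ.exists_consistent v
    obtain ⟨j, hj, hS⟩ := hσ π hπ
    rwa [Nat.le_zero.1 hj, hπ.start] at hS
  | succ k ih =>
    intro v hv
    obtain ⟨σ, hσ⟩ := mem_winE_iff.1 hv
    rw [attr_succ]
    refine or_iff_not_imp_left.2 fun hvS => winE_next_subset_pre _ (mem_winE_iff.2 ⟨σ, ?_⟩)
    refine fun π hπ => ih (hπ.mem_winE_of_splice hσ ?_)
    rintro ρ hρ ⟨_ | j, hj, hS⟩
    · rw [splice_eqOn_Iic hρ (Set.mem_Iic.2 (Nat.zero_le 1)), hπ.start] at hS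
      exact absurd hS hvS
    · rw [Nat.add_comm, splice_add] at hS
      exact ⟨j, Nat.le_of_succ_le_succ hj, hS⟩

theorem exists_strategy_of_mem_pre (A : Arena V) (T : V → Set V) :
    ∃ σ : A.EveStrategy, ∀ v π, σ.Consistent v π →
      ∀ n, π n ∈ A.pre (T (π n)) → π (n + 1) ∈ T (π n) := by
  refine ⟨⟨fun _ u => A.succIn u (T u), fun _ u => A.edge_succIn u _⟩, fun v π hπ n hn => ?_⟩
  obtain ⟨hE, u, hu, hT⟩ | ⟨-, hT⟩ := hn
  · rw [(hπ.follows n).2 hE]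
    exact succIn_mem hu hT
  · exact hT _ (hπ.follows n).1

theorem exists_attractor_strategy (hSZ : S ⊆ A.pre Z) :
    ∃ σ : A.EveStrategy, ∀ v π, σ.Consistent v π → ∀ n,
      (π n ∈ S → π (n + 1) ∈ Z) ∧
      ∀ k, π n ∈ A.attr (k + 1) S → π n ∉ S → π (n + 1) ∈ A.attr k S := by
  classical
  let rank (u : V) : ℕ := sInf {k | u ∈ A.pre (A.attr k S)}
  obtain ⟨σ, hσ⟩ := A.exists_strategy_of_mem_pre fun u => if u ∈ S then Z else A.attr (rank u) S
  refine ⟨σ, fun v π hπ n => ⟨fun hS => ?_, fun k hk hS => ?_⟩⟩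
  · simpa only [if_pos hS, hSZ hS, true_imp_iff] using hσ v π hπ n
  · have hpre : π n ∈ A.pre (A.attr k S) := (attr_succ k S ▸ hk).resolve_left hS
    have hmem : k ∈ {k | π n ∈ A.pre (A.attr k S)} := hpre
    have hrank : π n ∈ A.pre (A.attr (rank (π n)) S) := Nat.sInf_mem ⟨k, hmem⟩
    refine monotone_attr S (Nat.sInf_le hmem) ?_
    simpa only [if_neg hS, hrank, true_imp_iff] using hσ v π hπ n

end Attractor

section Switch

open Classical in
/-- Eve plays `σ` until the first visit to `W`, and from then on the strategy `τ u` attached to the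
vertex `u` of that visit, forgetting what happened before. -/
noncomputable def EveStrategy.switch (σ : A.EveStrategy) (W : Set V) (τ : V → A.EveStrategy) :
    A.EveStrategy where
  move w v :=
    match (w ++ [v.1]).find? (· ∈ W) with
    | some u => (τ u).move (w.dropWhile (· ∉ W)) v
    | none => σ.move w v
  legal w v := by
    split
    · exact (τ _).legal _ _
    · exact σ.legal _ _

variable {σ : A.EveStrategy} {W : Set V} {τ : V → A.EveStrategy} {v : V} {π : ℕ → V}

theorem EveStrategy.Consistent.of_switch_of_forall_notMem (hπ : (σ.switch W τ).Consistent v π)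
    (hW : ∀ n, π n ∉ W) : σ.Consistent v π := by
  classical
  refine ⟨hπ.start, fun n => ⟨(hπ.follows n).1, fun hE => ((hπ.follows n).2 hE).trans ?_⟩⟩
  have hfind : (history π n ++ [π n]).find? (fun u => decide (u ∈ W)) = none := by
    rw [← history_succ, List.find?_eq_none]
    intro u hu
    obtain ⟨i, -, rfl⟩ := mem_history.1 hu
    simpa using hW i
  simp only [switch, hfind]

theorem EveStrategy.Consistent.of_switch_of_first_visit {n : ℕ}
    (hπ : (σ.switch W τ).Consistent v π) (hn : π n ∈ W) (hmin : ∀ k < n, π k ∉ W) :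
    (τ (π n)).Consistent (π n) (fun k => π (n + k)) := by
  classical
  refine ⟨rfl, fun k => ⟨(hπ.follows (n + k)).1, fun hE => ((hπ.follows (n + k)).2 hE).trans ?_⟩⟩
  have hbefore : ∀ u ∈ history π n, u ∉ W := by
    intro u hu
    obtain ⟨i, hi, rfl⟩ := mem_history.1 hu
    exact hmin i hi
  have hhead (k : ℕ) : history (fun i => π (n + i)) (k + 1) =
      π n :: history (fun i => π (n + 1 + i)) k := by
    rw [Nat.add_comm k, history_add]
    simp [history, Nat.add_assoc]
  have hfind : (history π (n + k) ++ [π (n + k)]).find? (fun u => decide (u ∈ W)) =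
      some (π n) := by
    rw [← history_succ, Nat.add_assoc, history_add, List.find?_append, hhead,
      List.find?_eq_none.2 (by simpa using hbefore), List.find?_cons_of_pos (by simpa using hn)]
    rfl
  have hdrop : (history π (n + k)).dropWhile (fun u => decide (u ∉ W)) =
      history (fun i => π (n + i)) k := by
    rw [history_add, List.dropWhile_append_of_pos (by simpa using hbefore)]
    cases k with
    | zero => rfl
    | succ k => rw [hhead, List.dropWhile_cons_of_neg (by simpa using hn)]
  simp only [switch, hfind, hdrop]

theorem winE_visit_or_subset {Ω : Set (ℕ → V)} (hΩ : ∀ π n, (fun k => π (n + k)) ∈ Ω → π ∈ Ω) :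
    A.winE {π | (∃ n, π n ∈ A.winE Ω) ∨ π ∈ Ω} ⊆ A.winE Ω := by
  classical
  intro v hv
  obtain ⟨σ, hσ⟩ := mem_winE_iff.1 hv
  have : Nonempty A.EveStrategy := ⟨σ⟩
  choose! τ hτ using fun u (hu : u ∈ A.winE Ω) => mem_winE_iff.1 hu
  refine mem_winE_iff.2 ⟨σ.switch (A.winE Ω) τ, fun π hπ => ?_⟩
  by_cases hW : ∃ n, π n ∈ A.winE Ω
  · have hfirst := hπ.of_switch_of_first_visit (Nat.find_spec hW) fun _ => Nat.find_min hW
    exact hΩ π _ (hτ _ (Nat.find_spec hW) _ hfirst)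
  · exact (hσ π (hπ.of_switch_of_forall_notMem (not_exists.1 hW))).resolve_left hW

end Switch

end Arena

section BuchiConditions

variable {V : Type*} {F G : Set V} {π : ℕ → V} {N : ℕ}

theorem buchiDist_le_natCast_iff {k : ℕ} : buchiDist F π k ≤ N ↔ ∃ j ≤ N, π (k + j) ∈ F := by
  rw [← ENat.lt_natCast_add_one_iff]
  simp only [buchiDist, iInf_lt_iff]
  constructor
  · rintro ⟨k', ⟨hk, hF⟩, hlt⟩
    exact ⟨k' - k, by exact_mod_cast ENat.lt_natCast_add_one_iff.1 hlt,
      by rwa [Nat.add_sub_cancel' hk]⟩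
  · rintro ⟨j, hj, hF⟩
    refine ⟨k + j, ⟨Nat.le_add_right k j, hF⟩, ?_⟩
    rw [Nat.add_sub_cancel_left, ENat.lt_natCast_add_one_iff]
    exact_mod_cast hj

theorem natCast_lt_buchiDist_iff {k : ℕ} : N < buchiDist F π k ↔ ∀ j ≤ N, π (k + j) ∉ F := by
  rw [← not_le, buchiDist_le_natCast_iff]
  push Not
  rfl

theorem natCast_lt_buchiDist_congr {ρ : ℕ → V} {k : ℕ} (h : Set.EqOn π ρ (Set.Iic (k + N))) :
    N < buchiDist F π k ↔ N < buchiDist F ρ k := by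
  simp only [natCast_lt_buchiDist_iff]
  refine forall₂_congr fun j hj => ?_
  rw [h (Set.mem_Iic.2 (Nat.add_le_add_left hj k))]

theorem buchiDist_anti (h : F ⊆ G) (π : ℕ → V) (k : ℕ) : buchiDist G π k ≤ buchiDist F π k :=
  biInf_mono fun _ hk => ⟨hk.1, h hk.2⟩

theorem buchiDist_union_of_forall_notMem (h : ∀ n, π n ∉ G) :
    buchiDist (F ∪ G) π = buchiDist F π := by
  funext k
  simp only [buchiDist, Set.mem_union, h, or_false]

theorem buchiDist_shift (F : Set V) (π : ℕ → V) (n k : ℕ) :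
    buchiDist F (fun i => π (n + i)) k = buchiDist F π (n + k) := by
  refine le_antisymm (le_iInf₂ fun k' hk' => ?_) (le_iInf₂ fun k' hk' => ?_)
  · have hF : π (n + (k' - n)) ∈ F := by
      rw [Nat.add_sub_cancel' (le_of_add_le_left hk'.1)]
      exact hk'.2
    exact iInf₂_le_of_le (k' - n) ⟨Nat.le_sub_of_add_le' hk'.1, hF⟩ (by rw [Nat.sub_sub])
  · exact iInf₂_le_of_le (n + k') ⟨Nat.add_le_add_left hk'.1 n, hk'.2⟩
      (by rw [Nat.add_sub_add_left])

theorem mem_bndBuchi_iff : π ∈ BndBuchi F N ↔ ∀ k, buchiDist F π k ≤ N := by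
  rw [BndBuchi, Set.mem_ofPred_eq, iSup_le_iff]

theorem shift_mem_bndBuchi (h : π ∈ BndBuchi F N) (n : ℕ) :
    (fun k => π (n + k)) ∈ BndBuchi F N :=
  mem_bndBuchi_iff.2 fun k => buchiDist_shift F π n k ▸ mem_bndBuchi_iff.1 h (n + k)

theorem bndBuchi_subset_uniformBuchi (F : Set V) (N : ℕ) : BndBuchi F N ⊆ UniformBuchi F N :=
  fun _ h => le_trans Filter.limsup_le_iSup h.out

theorem limsup_buchiDist_shift (F : Set V) (π : ℕ → V) (n : ℕ) :
    Filter.limsup (buchiDist F fun k => π (n + k)) Filter.atTop =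
      Filter.limsup (buchiDist F π) Filter.atTop := by
  rw [funext (buchiDist_shift F π n), ← Filter.limsup_nat_add (buchiDist F π) n]
  simp only [Nat.add_comm n]

theorem mem_uniformBuchi_iff : π ∈ UniformBuchi F N ↔ ∀ᶠ k in Filter.atTop, buchiDist F π k ≤ N :=
  ⟨fun h => (Filter.eventually_lt_of_limsup_lt (ENat.lt_natCast_add_one_iff.2 h)).mono
    fun _ => ENat.lt_natCast_add_one_iff.1, fun h => Filter.limsup_le_of_le (h := h)⟩

theorem mem_finBuchi_iff : π ∈ FinBuchi F ↔ ∃ N, π ∈ UniformBuchi F N := by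
  refine ⟨fun h => ?_, fun ⟨N, hN⟩ => hN.trans_lt (ENat.natCast_lt_top N)⟩
  obtain ⟨N, hN⟩ := ENat.ne_top_iff_exists.1 h.ne
  exact ⟨N, hN.ge⟩

end BuchiConditions

namespace Arena

variable {V : Type*} {A : Arena V}

section Bounded

theorem winE_bndBuchi_subset_attrPre (F : Set V) (N : ℕ) :
    A.winE (BndBuchi F N) ⊆ A.attrPre N F (A.winE (BndBuchi F N)) := by
  intro v hv
  obtain ⟨σ, hσ⟩ := mem_winE_iff.1 hv
  refine winE_reach_subset_attr N _ (mem_winE_iff.2 ⟨σ, fun π hπ => ?_⟩)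
  obtain ⟨j, hj, hF⟩ := buchiDist_le_natCast_iff.1 (mem_bndBuchi_iff.1 (hσ π hπ) 0)
  have hΩ : ∀ π ∈ BndBuchi F N, ∀ n, (fun k => π (n + k)) ∈ BndBuchi F N :=
    fun _ => shift_mem_bndBuchi
  exact ⟨j, hj, Nat.zero_add j ▸ hF,
    winE_subset_pre_of_suffix_closed hΩ (hπ.mem_winE_of_suffix_closed hΩ hσ j)⟩

theorem gfp_attrPre_subset_winE_bndBuchi (F : Set V) (N : ℕ) :
    (A.attrPre N F).gfp ⊆ A.winE (BndBuchi F N) := by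
  intro v hv
  set Z := (A.attrPre N F).gfp
  have hfix : A.attr N (F ∩ A.pre Z) = Z := (A.attrPre N F).map_gfp
  obtain ⟨σ, hσ⟩ := exists_attractor_strategy (S := F ∩ A.pre Z) Set.inter_subset_right
  refine mem_winE_iff.2 ⟨σ, fun π hπ => ?_⟩
  have hstay (n : ℕ) (hn : π n ∈ Z) : π (n + 1) ∈ Z := by
    by_cases hS : π n ∈ F ∩ A.pre Z
    · exact (hσ v π hπ n).1 hS
    · rw [← hfix] at hn
      cases N with
      | zero => exact absurd hn hS
      | succ N => exact hfix ▸ monotone_attr _ N.le_succ ((hσ v π hπ n).2 N hn hS)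
  have hZ (n : ℕ) : π n ∈ Z :=
    Nat.rec (hπ.start.symm ▸ hv) hstay n
  have hreach (k n : ℕ) (hn : π n ∈ A.attr k (F ∩ A.pre Z)) : ∃ j ≤ k, π (n + j) ∈ F := by
    induction k generalizing n with
    | zero => exact ⟨0, le_rfl, hn.1⟩
    | succ k ih =>
      by_cases hS : π n ∈ F ∩ A.pre Z
      · exact ⟨0, Nat.zero_le _, hS.1⟩
      · obtain ⟨j, hj, hF⟩ := ih (n + 1) ((hσ v π hπ n).2 k hn hS)
        exact ⟨1 + j, by omega, by rwa [← Nat.add_assoc]⟩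
  exact mem_bndBuchi_iff.2 fun n =>
    buchiDist_le_natCast_iff.2 (hreach N n (hfix.symm ▸ hZ n))

theorem winE_bndBuchi (F : Set V) (N : ℕ) : A.winE (BndBuchi F N) = (A.attrPre N F).gfp :=
  (OrderHom.le_gfp _ (winE_bndBuchi_subset_attrPre F N)).antisymm
    (gfp_attrPre_subset_winE_bndBuchi F N)

end Bounded

section Delays

variable {G X : Set V} {σ : A.EveStrategy} {v : V}

theorem EveStrategy.Consistent.exists_delay {π : ℕ → V} {n N : ℕ} (hπ : σ.Consistent v π)
    (hn : π n ∉ A.winE (BndBuchi G N)) :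
    ∃ ρ, σ.Consistent v ρ ∧ Set.EqOn ρ π (Set.Iic n) ∧ ∃ k ≥ n, N < buchiDist G ρ k := by
  simp only [mem_winE_iff, mem_bndBuchi_iff] at hn
  push Not at hn
  obtain ⟨ρ, hρ, k, hk⟩ := hn (σ.residual (history π n))
  refine ⟨_, hπ.splice hρ, splice_eqOn_Iic hρ.start, n + k, Nat.le_add_right n k, ?_⟩
  simpa only [← buchiDist_shift, splice_add] using hk

theorem exists_consistent_delays {f : ℕ → ℕ} (hf : ∀ i, 1 ≤ f i) (hXG : X ⊆ G)
    (hX : ∀ i, A.winE (BndBuchi G (f i)) ⊆ X) (σ : A.EveStrategy) (hv : v ∉ X) :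
    ∃ π, σ.Consistent v π ∧ ∀ i, ∃ k ≥ i, f i < buchiDist G π k := by
  -- A consistent play together with a position outside `X` up to which it is settled.
  let State := {p : (ℕ → V) × ℕ // σ.Consistent v p.1 ∧ p.1 p.2 ∉ X}
  have hstep (i : ℕ) (p : State) : ∃ q : State, p.1.2 < q.1.2 ∧
      Set.EqOn q.1.1 p.1.1 (Set.Iic p.1.2) ∧
      ∃ k ≥ p.1.2, k + f i ≤ q.1.2 ∧ f i < buchiDist G q.1.1 k := by
    obtain ⟨ρ, hρ, heq, k, hk, hdelay⟩ := p.2.1.exists_delay fun h => p.2.2 (hX i h)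
    have hend : ρ (k + f i) ∉ X := fun h => natCast_lt_buchiDist_iff.1 hdelay _ le_rfl (hXG h)
    exact ⟨⟨(ρ, k + f i), hρ, hend⟩, hk.trans_lt (Nat.lt_add_of_pos_right (hf i)), heq,
      k, hk, le_rfl, hdelay⟩
  choose next hlt heq k hk hkf hdelay using hstep
  obtain ⟨π₀, hπ₀⟩ := σ.exists_consistent v
  have hstart : π₀ 0 ∉ X := hπ₀.start.symm ▸ hv
  let p (i : ℕ) : State := Nat.rec ⟨(π₀, 0), hπ₀, hstart⟩ next i
  have hmono : StrictMono fun i => (p i).1.2 := strictMono_nat_of_lt_succ fun i => hlt i (p i)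
  obtain ⟨π, hπ⟩ :=
    exists_eqOn_Iic_of_eqOn_succ (p := fun i => (p i).1.1) hmono fun i => heq i (p i)
  refine ⟨π, .of_forall_eqOn_Iic fun n => ⟨(p n).1.1, (p n).2.1, ?_⟩, fun i => ?_⟩
  · exact (hπ n).mono (Set.Iic_subset_Iic.2 hmono.le_apply)
  · refine ⟨k i (p i), hmono.le_apply.trans (hk i (p i)), ?_⟩
    have hwindow : Set.EqOn π (p (i + 1)).1.1 (Set.Iic (k i (p i) + f i)) :=
      (hπ (i + 1)).mono (Set.Iic_subset_Iic.2 (hkf i (p i)))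
    exact (natCast_lt_buchiDist_congr hwindow).2 (hdelay i (p i))

end Delays

section Fixpoints

variable {F X : Set V} {N : ℕ}

theorem winE_uniformBuchi_subset (hN : 1 ≤ N) (hX : A.winE (BndBuchi (F ∪ X) N) ⊆ X) :
    A.winE (UniformBuchi F N) ⊆ X := by
  intro v hv
  by_contra hvX
  obtain ⟨σ, hσ⟩ := mem_winE_iff.1 hv
  obtain ⟨π, hπ, hdelay⟩ :=
    exists_consistent_delays (fun _ => hN) Set.subset_union_right (fun _ => hX) σ hvX
  obtain ⟨m, hm⟩ := Filter.eventually_atTop.1 (mem_uniformBuchi_iff.1 (hσ π hπ))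
  obtain ⟨k, hk, hlt⟩ := hdelay m
  exact hlt.not_ge ((buchiDist_anti Set.subset_union_left π k).trans (hm k hk))

theorem winE_finBuchi_subset (hX : ∀ N, 1 ≤ N → A.winE (BndBuchi (F ∪ X) N) ⊆ X) :
    A.winE (FinBuchi F) ⊆ X := by
  intro v hv
  by_contra hvX
  obtain ⟨σ, hσ⟩ := mem_winE_iff.1 hv
  obtain ⟨π, hπ, hdelay⟩ := exists_consistent_delays (fun i => Nat.le_add_left 1 i)
    Set.subset_union_right (fun i => hX (i + 1) (Nat.le_add_left 1 i)) σ hvX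
  obtain ⟨N, hN⟩ := mem_finBuchi_iff.1 (hσ π hπ)
  obtain ⟨m, hm⟩ := Filter.eventually_atTop.1 (mem_uniformBuchi_iff.1 hN)
  obtain ⟨k, hk, hlt⟩ := hdelay (max m N)
  have hle : buchiDist (F ∪ X) π k ≤ N :=
    (buchiDist_anti Set.subset_union_left π k).trans (hm k ((le_max_left m N).trans hk))
  exact hlt.not_ge (hle.trans (by exact_mod_cast (le_max_right m N).trans (Nat.le_succ _)))

theorem winE_bndBuchi_union_winE_uniformBuchi_subset (F : Set V) (N : ℕ) :
    A.winE (BndBuchi (F ∪ A.winE (UniformBuchi F N)) N) ⊆ A.winE (UniformBuchi F N) := by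
  refine (winE_mono fun π hπ => or_iff_not_imp_left.2 fun hW => ?_).trans
    (winE_visit_or_subset fun π n h => ?_)
  · rw [BndBuchi, Set.mem_ofPred_eq, buchiDist_union_of_forall_notMem (not_exists.1 hW)] at hπ
    exact bndBuchi_subset_uniformBuchi F N hπ
  · rwa [UniformBuchi, Set.mem_ofPred_eq, limsup_buchiDist_shift] at h

theorem winE_uniformBuchi_union_winE_finBuchi_subset (F : Set V) (N : ℕ) :
    A.winE (UniformBuchi (F ∪ A.winE (FinBuchi F)) N) ⊆ A.winE (FinBuchi F) := by
  refine (winE_mono fun π hπ => or_iff_not_imp_left.2 fun hW => ?_).trans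
    (winE_visit_or_subset fun π n h => ?_)
  · rw [UniformBuchi, Set.mem_ofPred_eq, buchiDist_union_of_forall_notMem (not_exists.1 hW)] at hπ
    exact mem_finBuchi_iff.2 ⟨N, hπ⟩
  · rwa [FinBuchi, Set.mem_ofPred_eq, limsup_buchiDist_shift] at h

theorem uniformOp_apply (N : ℕ) (F Y : Set V) :
    A.uniformOp N F Y = A.winE (BndBuchi (F ∪ Y) N) :=
  (winE_bndBuchi (F ∪ Y) N).symm

theorem winE_uniformBuchi (F : Set V) (hN : 1 ≤ N) :
    A.winE (UniformBuchi F N) = (A.uniformOp N F).lfp := by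
  apply Set.Subset.antisymm
  · refine winE_uniformBuchi_subset hN ?_
    rw [← uniformOp_apply, OrderHom.map_lfp]
  · refine OrderHom.lfp_le _ ?_
    rw [uniformOp_apply]
    exact winE_bndBuchi_union_winE_uniformBuchi_subset F N

theorem finitaryInnerOp_eq_uniformOp (N : ℕ) (F X : Set V) :
    A.finitaryInnerOp N F X = A.uniformOp N (F ∪ X) := by
  ext1
  funext Y
  change (A.attrPre N (F ∪ Y ∪ X)).gfp = (A.attrPre N (F ∪ X ∪ Y)).gfp
  rw [Set.union_right_comm]

theorem monotone_lfp_finitaryInnerOp (F X : Set V) :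
    Monotone fun N => (A.finitaryInnerOp N F X).lfp :=
  fun _ _ h => OrderHom.lfp.monotone fun _ => OrderHom.gfp.monotone fun _ => monotone_attr _ h

theorem finitaryOp_apply (F X : Set V) :
    A.finitaryOp F X = ⋃ N : ℕ, A.winE (UniformBuchi (F ∪ X) (N + 1)) := by
  -- `winE_uniformBuchi` needs a positive bound, and the union is increasing in the bound.
  simp only [winE_uniformBuchi _ (Nat.le_add_left 1 _), ← finitaryInnerOp_eq_uniformOp]
  exact ((monotone_lfp_finitaryInnerOp F X).iUnion_nat_add 1).symm

theorem winE_finBuchi (F : Set V) : A.winE (FinBuchi F) = (A.finitaryOp F).lfp := by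
  set X := (A.finitaryOp F).lfp with hX
  have hfix : ⋃ N : ℕ, A.winE (UniformBuchi (F ∪ X) (N + 1)) = X := by
    rw [← finitaryOp_apply, hX, OrderHom.map_lfp]
  apply Set.Subset.antisymm
  · refine winE_finBuchi_subset fun N hN => ?_
    obtain ⟨N, rfl⟩ := Nat.exists_eq_add_of_le' hN
    exact (winE_mono (bndBuchi_subset_uniformBuchi _ _)).trans
      (Set.iUnion_subset_iff.1 hfix.subset N)
  · refine OrderHom.lfp_le _ ?_
    rw [finitaryOp_apply]
    exact Set.iUnion_subset fun N => winE_uniformBuchi_union_winE_finBuchi_subset F (N + 1)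

end Fixpoints

end Arena

theorem mainTheorem5_general {V : Type*} (A : Arena V) (F : Set V) :
    (∀ N : ℕ, A.winE (BndBuchi F N) = (A.attrPre N F).gfp) ∧
    (∀ N : ℕ, 1 ≤ N → A.winE (UniformBuchi F N) = (A.uniformOp N F).lfp) ∧
    A.winE (FinBuchi F) = (A.finitaryOp F).lfp :=
  ⟨Arena.winE_bndBuchi F, fun _ hN => Arena.winE_uniformBuchi F hN, Arena.winE_finBuchi F⟩

theorem mainTheorem5 {V : Type*} [Countable V] (A : Arena V) (F : Set V) :
    (∀ N : ℕ, A.winE (BndBuchi F N) = (A.attrPre N F).gfp) ∧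
    (∀ N : ℕ, 1 ≤ N → A.winE (UniformBuchi F N) = (A.uniformOp N F).lfp) ∧
    A.winE (FinBuchi F) = (A.finitaryOp F).lfp :=
  mainTheorem5_general A F
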